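/- **Setting.** Let $d\ge 1$, $p\ge 0$, and let $(X_t)_{t\in\mathbb Z}$, $X_t=(X_{t,1},\dots,X_{t,d})\in\mathbb R^d$, be a strictly stationary and absolutely regular ($\beta$-mixing, $\beta(n)\to0$) series. All expectations $\mathbb E$ are with respect to its true distribution, which need not belong to the model below. **Model.** Let $\mathcal V=(V_k,E_k)_{k=1}^{(p+1)d-1}$ be a regular vine on $V_1=\{1,\dots,1+p\}\times\{1,\dots,d\}$ (each $(V_k,E_k)$ is a tree, $V_{k+1}=E_k$, and two edges of $E_k$ joined by an edge of $E_{k+1}$ share exactly one vertex). An edge $e$ has label $(a_e,b_e\mid D_e)$, where, $\mathcal U_v\subseteq V_1$ being the set of elements of $V_1$ from which $v$ is built, $e=\{v_1,v_2\}$ has $D_e=\mathcal U_{v_1}\cap\mathcal U_{v_2}$ and $\{a_e,b_e\}=(\mathcal U_{v_1}\cup\mathcal U_{v_2})\setminus D_e$ (ordered lexicographically). Write $e\sim e'$ if the labels agree up to a shift in time, and $[e]$ for the class of $e$. Assume $\mathcal V$ is stationary: for each $m\le p$ all restrictions of $\mathcal V$ to $m+1$ consecutive time points are time translations of one and the same vine.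 Let $f_j(\cdot;\eta_j)$, $\eta_j\in\mathcal H_j$, $j=1,\dots,d$, be parametric families of densities on $\mathbb R$ with distribution functions $F_j(\cdot;\eta_j)$, and for each class $[e]$ let $c_{[e]}(\cdot,\cdot;\theta_{[e]})$, $\theta_{[e]}\in\Theta_{[e]}$, be a parametric family of bivariate copula densities with copulas $C_{[e]}$; edges of the vine of the whole series spanning more than $p$ time steps carry the independence copula. The parameter sets are subsets of Euclidean spaces on which derivatives (taken within the set) are unique, e.g. open sets or convex sets with non-empty interior; $\mathcal H=\prod_j\mathcal H_j$, $\Theta=\prod_{[e]}\Theta_{[e]}$. For a window $x=(x_1,\dots,x_{1+p})$ put $u_{(t,j)}=F_j(x_{t,j};\eta_j)$ and define recursively, for an edge $e'$ with conditioned set $\{i,j\}$ and $D'=D_{e'}$, $u_{i\mid D'\cup\{j\}}=\partial C_{[e']}(u_{a_{e'}\mid D'},u_{b_{e'}\mid D'};\theta_{[e']})/\partial u_{j\mid D'}$. Each class is represented by its edge $e$ that starts at time $1$; write $F_{[e],1,\eta,\theta}(x)=u_{a_e\mid D_e}$, $F_{[e],2,\eta,\theta}(x)=u_{b_e\mid D_e}$,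 and define the scores $$s_{j,\eta_j}(x)=\nabla_{\eta_j}\ln f_j(x_{1,j};\eta_j),\qquad s_{[e],\eta,\theta}(x)=\nabla_{\theta_{[e]}}\ln c_{[e]}\{F_{[e],1,\eta,\theta}(x),F_{[e],2,\eta,\theta}(x);\theta_{[e]}\}$$ (the last gradient with $F_{[e],1},F_{[e],2}$ held fixed), $\phi_{\eta,\theta}=\bigl((s_{j,\eta_j})_j,(s_{[e],\eta,\theta})_{[e]}\bigr)$. **Estimator and pseudo-true values.** The pseudo-true values $(\eta^*,\theta^*)$ satisfy $\mathbb E\,\phi_{\eta^*,\theta^*}(X_1,\dots,X_{1+p})=0$. The parametric step-wise MLE $(\hat\eta,\hat\theta)=(\hat\eta_T,\hat\theta_T)$ is a solution in $\mathcal H\times\Theta$, with probability tending to one, of the estimating equation $\frac1T\sum_{t=1}^T\phi_{\eta,\theta}(X_t,\dots,X_{t+p})=0$, where for each $[e]$ a fixed finite number $r_{[e]}\ge0$ of the last terms of the sum may be left out. It is assumed not to leave compact subsets of the parameter set: for every $\delta>0$ there is a compact $K\subseteq\mathcal H\times\Theta$ with $\Pr\{(\hat\eta_T,\hat\theta_T)\notin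 K\}\le\delta$ for all large $T$ (which is automatic if $\mathcal H$ and $\Theta$ are compact). **Conditions.** (P1) $(\eta^*,\theta^*)$ lies in the interior of $\mathcal H\times\Theta$ and, for every $\epsilon>0$, $$\inf_{(\eta,\theta)\in\mathcal H\times\Theta,\ \|(\eta,\theta)-(\eta^*,\theta^*)\|>\epsilon}\bigl\|\mathbb E\,\phi_{\eta,\theta}(X_1,\dots,X_{1+p})\bigr\|>0 .$$ (P2) For almost every value $x$ of $(X_1,\dots,X_{1+p})$, the following holds at all parameters in $\mathcal H\times\Theta$: the densities in the definition of the scores are positive, their logarithms are differentiable in their own parameter, and $(\eta,\theta)\mapsto\phi_{\eta,\theta}(x)$ is continuously differentiable; moreover, for all compact $\tilde{\mathcal H}\subseteq\mathcal H$, $\tilde\Theta\subseteq\Theta$, $$\mathbb E\Bigl[\sup_{\eta\in\tilde{\mathcal H}}\sup_{\theta\in\tilde\Theta}\bigl\{\|\phi_{\eta,\theta}(X_1,\dots,X_{1+p})\|+\|\nabla'_{(\eta,\theta)}\phi_{\eta,\theta}(X_1,\dots,X_{1+p})\|\bigr\}\Bigr]<\infty .$$ **Theorem.** Under (P1) and (P2),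 $(\hat\eta_T,\hat\theta_T)\to(\eta^*,\theta^*)$ in probability as $T\to\infty$. -/

import Mathlib

open MeasureTheory ProbabilityTheory Filter Topology
open scoped ENNReal

noncomputable section

namespace SVine

/-! ## Regular vines -/

/-- Iterated unordered pairs over `α`: level `0` is `α` itself, and the objects of level `k + 1`
are unordered pairs of objects of level `k`. The `k`-th tree (counting from `0`) of a vine on a
subset of `α` has vertices of type `Node α k` and edges of type `Sym2 (Node α k)`, which are
the vertices of the next tree. -/
@[reducible] def Node (α : Type) : ℕ → Type
  | 0 => α
  | k + 1 => Sym2 (Node α k)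

/-- A sequence of edge sets, one for each tree. -/
abbrev EdgeSeq (α : Type) : Type := ∀ k : ℕ, Finset (Sym2 (Node α k))

/-- The vertex sets of the trees: `V₁ = S`, and `V_{k+1} = E_k`. -/
def verts {α : Type} (S : Finset α) (E : EdgeSeq α) : ∀ k : ℕ, Finset (Node α k)
  | 0 => S
  | k + 1 => E k

/-- The graph formed by the `k`-th vertex and edge set. -/
def treeGraph {α : Type} (S : Finset α) (E : EdgeSeq α) (k : ℕ) :
    SimpleGraph {v : Node α k // v ∈ verts S E k} where
  Adj a b := a ≠ b ∧ s(a.1, b.1) ∈ E k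
  symm := ⟨fun a b h => ⟨h.1.symm, by rw [Sym2.eq_swap]; exact h.2⟩⟩
  loopless := ⟨fun _ h => h.1 rfl⟩

/-- A regular vine on the finite set `S` (with `N` elements): a sequence of `N - 1` trees, in which
the edges of one tree are the vertices of the next one, with the proximity condition. -/
structure RVine {α : Type} (S : Finset α) where
  /-- the edge sets `E_1, E_2, …` (indexed from `0`) -/
  E : EdgeSeq α
  edges_join_verts : ∀ k, ∀ e ∈ E k, ¬ e.IsDiag ∧ ∀ v ∈ e, v ∈ verts S E k
  isTree : ∀ k, k < S.card - 1 → (treeGraph S E k).IsTree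
  no_more_trees : ∀ k, S.card - 1 ≤ k → E k = ∅
  proximity : ∀ k, ∀ a b : Sym2 (Node α k), (s(a, b) : Sym2 (Node α (k + 1))) ∈ E (k + 1) →
    ∃! v : Node α k, v ∈ a ∧ v ∈ b

/-- The complete union of a vertex of the `k`-th tree. -/
def completeUnion {α : Type} : ∀ k : ℕ, Node α k → Set α
  | 0, i => {i}
  | k + 1, e => {i | ∃ v : Node α k, v ∈ (show Sym2 (Node α k) from e) ∧ i ∈ completeUnion k v}

/-- The conditioning set `D_e` of an edge: the intersection of the complete unions of its ends. -/
def conditioning {α : Type} {k : ℕ} (e : Sym2 (Node α k)) : Set α :=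
  {i | ∀ v ∈ e, i ∈ completeUnion k v}

/-- The conditioned set `{a_e, b_e}` of an edge. -/
def conditioned {α : Type} {k : ℕ} (e : Sym2 (Node α k)) : Set α :=
  {i | ∃ v ∈ e, i ∈ completeUnion k v} \ conditioning e

/-! ## Vines for multivariate time series; stationary vines -/

/-- The vertex `(t, j)` stands for variable `j` at time `t`. -/
abbrev Vertex (d : ℕ) : Type := ℤ × Fin d

/-- The vertices `{t, …, t + m} × {1, …, d}`. -/
def block (d : ℕ) (t : ℤ) (m : ℕ) : Finset (Vertex d) :=
  Finset.Icc t (t + m) ×ˢ Finset.univ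

/-- Shift in time. -/
def shift {d : ℕ} (τ : ℤ) (v : Vertex d) : Vertex d := (v.1 + τ, v.2)

/-- `e = e' + (τ, 0)`, in terms of the labels of the two edges. The elements `a_e`, `b_e` of the
conditioned set will be ordered lexicographically, and shifts respect this order. -/
def EdgeShift {d k k' : ℕ} (e : Sym2 (Node (Vertex d) k)) (e' : Sym2 (Node (Vertex d) k'))
    (τ : ℤ) : Prop :=
  conditioned e = shift τ '' conditioned e' ∧ conditioning e = shift τ '' conditioning e'

open scoped Classical in
/-- Vertex sets of the restriction of a sequence of edge sets to the vertices in `S'`. -/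
def restrictVerts {α : Type} (E : EdgeSeq α) (S' : Finset α) : ∀ k : ℕ, Finset (Node α k)
  | 0 => S'
  | k + 1 => (E k).filter fun e => ∀ v ∈ e, v ∈ restrictVerts E S' k

/-- The restriction `E'_k = {e ∈ E_k : both ends of e lie in V'_k}`, where `V'_{k+1} = E'_k`. -/
def restrict {α : Type} (E : EdgeSeq α) (S' : Finset α) : EdgeSeq α :=
  fun k => restrictVerts E S' (k + 1)

/-- `E` is the translation of `E'` by `τ` time steps. -/
def IsTranslation {d : ℕ} (E E' : EdgeSeq (Vertex d)) (τ : ℤ) : Prop :=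
  ∀ k, (∀ e ∈ E k, ∃ e' ∈ E' k, EdgeShift e e' τ) ∧ (∀ e' ∈ E' k, ∃ e ∈ E k, EdgeShift e e' τ)

/-- A vine on `{1, …, 1 + p} × {1, …, d}` is stationary if for every `m ≤ p` there is a vine on
`{1, …, 1 + m} × {1, …, d}` of which all restrictions to `m + 1` consecutive time points are
translations. -/
def RVine.IsStationary {d p : ℕ} (V : RVine (block d 1 p)) : Prop :=
  ∀ m : ℕ, m ≤ p → ∃ W : RVine (block d 1 m), ∀ t : ℤ, 1 ≤ t → t + m ≤ 1 + p →
    IsTranslation (restrict V.E (block d t m)) W.E (t - 1)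

/-- The edges of all trees of a vine. -/
abbrev RVine.Edge {α : Type} {S : Finset α} (V : RVine S) : Type :=
  Σ k : Fin (S.card - 1), {e : Sym2 (Node α k) // e ∈ V.E k}

lemma shift_zero {d : ℕ} : (shift 0 : Vertex d → Vertex d) = id := by
  funext v; simp [shift]

lemma shift_image_image {d : ℕ} (a b : ℤ) (s : Set (Vertex d)) :
    shift a '' (shift b '' s) = shift (b + a) '' s := by
  rw [Set.image_image]; simp only [shift, add_assoc]; rfl

/-- `e ∼ e'`: the edges are translations of one another. -/
def RVine.edgeSetoid {d p : ℕ} (V : RVine (block d 1 p)) : Setoid V.Edge where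
  r e e' := ∃ τ : ℤ, EdgeShift e.2.1 e'.2.1 τ
  iseqv :=
    { refl := fun e => ⟨0, by simp [EdgeShift, shift_zero]⟩
      symm := by
        rintro e e' ⟨τ, h1, h2⟩
        refine ⟨-τ, ?_, ?_⟩
        · rw [h1, shift_image_image]; simp [shift_zero]
        · rw [h2, shift_image_image]; simp [shift_zero]
      trans := by
        rintro e e' e'' ⟨τ, h1, h2⟩ ⟨σ, h3, h4⟩
        exact ⟨σ + τ, by rw [h1, h3, shift_image_image], by rw [h2, h4, shift_image_image]⟩ }

/-- The equivalence classes `[e]`. -/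
def RVine.EdgeClass {d p : ℕ} (V : RVine (block d 1 p)) : Type := Quotient V.edgeSetoid

/-- The class `[e]` of an edge. -/
def RVine.classOf {d p : ℕ} (V : RVine (block d 1 p)) (e : V.Edge) : V.EdgeClass :=
  Quotient.mk V.edgeSetoid e

instance {d p : ℕ} (V : RVine (block d 1 p)) : Finite V.EdgeClass :=
  inferInstanceAs (Finite (Quotient V.edgeSetoid))

instance {d p : ℕ} (V : RVine (block d 1 p)) : Fintype V.EdgeClass := Fintype.ofFinite _

open scoped Classical in
/-- The representative of a class of edges that starts at the first of the `1 + p` time points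
(it exists and is unique in a stationary vine). -/
def RVine.rep {d p : ℕ} (V : RVine (block d 1 p)) (q : V.EdgeClass) : V.Edge :=
  if h : ∃ e : V.Edge, V.classOf e = q ∧ ∃ v ∈ conditioned e.2.1 ∪ conditioning e.2.1,
    v.1 = 1 then h.choose else Quotient.out q

/-! ## Pair-copulas and the recursion for the conditional distributions -/

/-- `g` is a probability density on `ℝ`. -/
structure IsDensity (g : ℝ → ℝ) : Prop where
  measurable : Measurable g
  nonneg : ∀ x, 0 ≤ g x
  lintegral_eq_one : ∫⁻ x, ENNReal.ofReal (g x) = 1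

/-- `c` is a bivariate copula density: a density on the unit square with uniform margins. -/
structure IsCopulaDensity (c : ℝ → ℝ → ℝ) : Prop where
  measurable : Measurable (Function.uncurry c)
  nonneg : ∀ u ∈ Set.Ioo (0 : ℝ) 1, ∀ v ∈ Set.Ioo (0 : ℝ) 1, 0 ≤ c u v
  margin_fst : ∀ u ∈ Set.Icc (0 : ℝ) 1,
    ∫⁻ z in Set.Ioo 0 u ×ˢ Set.Ioo 0 1, ENNReal.ofReal (c z.1 z.2) = ENNReal.ofReal u
  margin_snd : ∀ v ∈ Set.Icc (0 : ℝ) 1,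
    ∫⁻ z in Set.Ioo 0 1 ×ˢ Set.Ioo 0 v, ENNReal.ofReal (c z.1 z.2) = ENNReal.ofReal v

/-- The distribution function with density `g`. -/
def cdfOf (g : ℝ → ℝ) (x : ℝ) : ℝ := ∫ y in Set.Iic x, g y

/-- The copula `C(u, v)` with density `c` on the unit square. -/
def copulaOf (c : ℝ → ℝ → ℝ) (u v : ℝ) : ℝ :=
  ∫ z in Set.Ioo 0 (min u 1) ×ˢ Set.Ioo 0 (min v 1), c z.1 z.2

open scoped Classical in
/-- The end of `e` whose complete union contains `i`, for `i` in the conditioned set of `e`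
(the other end does not contain `i`). -/
def side {α : Type} {k : ℕ} (e : Sym2 (Node α k)) (i : α) : Node α k :=
  if h : ∃ v ∈ e, i ∈ completeUnion k v then h.choose else (Quot.out e).1

open scoped Classical in
/-- The other element of the conditioned set of `e`, for `i` in the conditioned set. -/
def partner {α : Type} {k : ℕ} (e : Sym2 (Node α k)) (i : α) : α :=
  if h : ∃ j ∈ conditioned e, j ≠ i then h.choose else i

/-- Some element of the complete union, a default value. -/
def leaf {α : Type} : ∀ k : ℕ, Node α k → α
  | 0, i => i
  | k + 1, e => leaf k (Quot.out (show Sym2 (Node α k) from e)).1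

open scoped Classical in
/-- `a_e`, the lexicographically smaller element of the conditioned set. -/
def firstVar {d k : ℕ} (e : Sym2 (Node (Vertex d) k)) : Vertex d :=
  if h : ∃ i ∈ conditioned e, ∀ j ∈ conditioned e, toLex i ≤ toLex j then h.choose
  else leaf k (Quot.out e).1

/-- `b_e`, the other element of the conditioned set. -/
def secondVar {d k : ℕ} (e : Sym2 (Node (Vertex d) k)) : Vertex d := partner e (firstVar e)

open scoped Classical in
/-- The conditional distribution values. Given the copulas `C k e` of all edges and the values
`u i` of the variables, `condValue C u k v i` is `u_{i | U_v ∖ {i}}`, where `U_v` is the complete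
union of the vertex `v` and `i` is in the conditioned set of `v` (or `v = i`, at level `0`). If
`v = e'` is an edge with conditioned set `{i, j}` and conditioning set `D'`, this is the partial
derivative of `C_{e'}(u_{a_{e'}|D'}, u_{b_{e'}|D'})` with respect to `u_{j|D'}`. -/
def condValue {d : ℕ} (C : ∀ k : ℕ, Sym2 (Node (Vertex d) k) → ℝ → ℝ → ℝ) (u : Vertex d → ℝ) :
    ∀ k : ℕ, Node (Vertex d) k → Vertex d → ℝ
  | 0, _, i => u i
  | k + 1, e, i =>
    if toLex i < toLex (partner e i) then
      deriv (fun y => C k e (condValue C u k (side e i) i) y)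
        (condValue C u k (side e (partner e i)) (partner e i))
    else
      deriv (fun y => C k e y (condValue C u k (side e i) i))
        (condValue C u k (side e (partner e i)) (partner e i))

/-! ## Parametric stationary vine copula models of Markov order `p` -/

/-- A parametric model for the time series: a stationary vine on `1 + p` time points, parametric
families of marginal densities `f_j(·; η_j)`, `η_j ∈ H_j`, and one parametric family of
pair-copula densities `c_{[e]}(·, ·; θ_{[e]})`, `θ_{[e]} ∈ Θ_{[e]}`, for each class of edges.
The pair-copulas of all edges across more than `p` time steps are independence copulas.
Parameter sets are such that derivatives within them are unique. -/
structure Model (d p : ℕ) where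
  V : RVine (block d 1 p)
  stationary : V.IsStationary
  dimH : Fin d → ℕ
  H : ∀ j, Set (EuclideanSpace ℝ (Fin (dimH j)))
  uniqueDiffOn_H : ∀ j, UniqueDiffOn ℝ (H j)
  f : ∀ j, EuclideanSpace ℝ (Fin (dimH j)) → ℝ → ℝ
  isDensity : ∀ j, ∀ η ∈ H j, IsDensity (f j η)
  dimΘ : V.EdgeClass → ℕ
  Θ : ∀ q, Set (EuclideanSpace ℝ (Fin (dimΘ q)))
  uniqueDiffOn_Θ : ∀ q, UniqueDiffOn ℝ (Θ q)
  c : ∀ q, EuclideanSpace ℝ (Fin (dimΘ q)) → ℝ → ℝ → ℝ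
  isCopulaDensity : ∀ q, ∀ θ ∈ Θ q, IsCopulaDensity (c q θ)

namespace Model

variable {d p : ℕ} (M : Model d p)

/-- The space of `η = (η_1, …, η_d)`. -/
abbrev EtaSpace : Type := ∀ j : Fin d, EuclideanSpace ℝ (Fin (M.dimH j))

/-- The space of `θ = (θ_{[e]})_{[e]}`. -/
abbrev ThetaSpace : Type := ∀ q : M.V.EdgeClass, EuclideanSpace ℝ (Fin (M.dimΘ q))

/-- The set `𝓗` of marginal parameters. -/
def etaSet : Set M.EtaSpace := Set.univ.pi M.H

/-- The set `Θ` of copula parameters. -/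
def thetaSet : Set M.ThetaSpace := Set.univ.pi M.Θ

open scoped Classical in
/-- The copula `C_{[e]}(·, ·; θ_{[e]})` of an edge of the vine. -/
def pairCopula (θ : M.ThetaSpace) (k : ℕ) (e : Sym2 (Node (Vertex d) k)) : ℝ → ℝ → ℝ :=
  if h : k < (block d 1 p).card - 1 ∧ e ∈ M.V.E k then
    copulaOf (M.c (M.V.classOf ⟨⟨k, h.1⟩, ⟨e, h.2⟩⟩) (θ (M.V.classOf ⟨⟨k, h.1⟩, ⟨e, h.2⟩⟩)))
  else 0

/-- The values `F_j(x_{t, j}; η_j)` for the window `x = (x_1, …, x_{1+p})`. -/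
def margValue (η : M.EtaSpace) (x : Fin (p + 1) → Fin d → ℝ) (v : Vertex d) : ℝ :=
  cdfOf (M.f v.2 (η v.2)) (x (Fin.ofNat (p + 1) (v.1 - 1).toNat) v.2)

/-- `F_{a_e | D_e}(x_{a_e} | x_{D_e}; η, θ)`. -/
def F₁ (η : M.EtaSpace) (θ : M.ThetaSpace) (e : M.V.Edge) (x : Fin (p + 1) → Fin d → ℝ) : ℝ :=
  condValue (M.pairCopula θ) (M.margValue η x) e.1 (side e.2.1 (firstVar e.2.1))
    (firstVar e.2.1)

/-- `F_{b_e | D_e}(x_{b_e} | x_{D_e}; η, θ)`. -/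
def F₂ (η : M.EtaSpace) (θ : M.ThetaSpace) (e : M.V.Edge) (x : Fin (p + 1) → Fin d → ℝ) : ℝ :=
  condValue (M.pairCopula θ) (M.margValue η x) e.1 (side e.2.1 (secondVar e.2.1))
    (secondVar e.2.1)

/-- Marginal log-density `ln f_j(x_{1, j}; η_j)` at the first time point of the window. -/
def logMarg (j : Fin d) (x : Fin (p + 1) → Fin d → ℝ) (ηj : EuclideanSpace ℝ (Fin (M.dimH j))) :
    ℝ := Real.log (M.f j ηj (x 0 j))

/-- The density `c_{[e]}{F_{[e],1,η,θ}(x), F_{[e],2,η,θ}(x); ϑ}`. -/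
def pairDensity (q : M.V.EdgeClass) (η : M.EtaSpace) (θ : M.ThetaSpace)
    (x : Fin (p + 1) → Fin d → ℝ) (ϑ : EuclideanSpace ℝ (Fin (M.dimΘ q))) : ℝ :=
  M.c q ϑ (M.F₁ η θ (M.V.rep q) x) (M.F₂ η θ (M.V.rep q) x)

/-- The marginal score `s_{j, η_j}`. -/
def margScore (η : M.EtaSpace) (x : Fin (p + 1) → Fin d → ℝ) (j : Fin d) :
    EuclideanSpace ℝ (Fin (M.dimH j)) :=
  gradientWithin (M.logMarg j x) (M.H j) (η j)

/-- The pair-copula score `s_{[e], η, θ}`: the gradient with respect to `θ_{[e]}` only, the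
arguments of the pair-copula density being held fixed. -/
def pairScore (η : M.EtaSpace) (θ : M.ThetaSpace) (x : Fin (p + 1) → Fin d → ℝ)
    (q : M.V.EdgeClass) : EuclideanSpace ℝ (Fin (M.dimΘ q)) :=
  gradientWithin (fun ϑ => Real.log (M.pairDensity q η θ x ϑ)) (M.Θ q) (θ q)

/-- The stacked step-wise score `φ^{(P)}_{η, θ}(x_1, …, x_{1+p})`. -/
def score (α : M.EtaSpace × M.ThetaSpace) (x : Fin (p + 1) → Fin d → ℝ) :
    M.EtaSpace × M.ThetaSpace :=
  (M.margScore α.1 x, M.pairScore α.1 α.2 x)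

/-- The scores are well defined for almost all observations `x ∼ μ`: the densities are positive and
the log-densities are differentiable with respect to their parameters. -/
def ScoreExists (μ : Measure (Fin (p + 1) → Fin d → ℝ)) : Prop :=
  ∀ᵐ x ∂μ, ∀ η ∈ M.etaSet, ∀ θ ∈ M.thetaSet,
    (∀ j, 0 < M.f j (η j) (x 0 j) ∧ DifferentiableWithinAt ℝ (M.logMarg j x) (M.H j) (η j)) ∧
    (∀ q, 0 < M.pairDensity q η θ x (θ q) ∧
      DifferentiableWithinAt ℝ (fun ϑ => Real.log (M.pairDensity q η θ x ϑ)) (M.Θ q) (θ q))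

/-- Pseudo-true values: `E φ_{η*, θ*}(X_1, …, X_{1+p}) = 0`. -/
def IsPseudoTrue (μ : Measure (Fin (p + 1) → Fin d → ℝ)) (α : M.EtaSpace × M.ThetaSpace) : Prop :=
  Integrable (M.score α) μ ∧ ∫ x, M.score α x ∂μ = 0

/-- Condition (P1): interior pseudo-true values that are the well-separated zero of `E φ`. -/
def CondP1 (μ : Measure (Fin (p + 1) → Fin d → ℝ)) (α : M.EtaSpace × M.ThetaSpace) : Prop :=
  α ∈ interior (M.etaSet ×ˢ M.thetaSet) ∧
  ∀ ε > 0, ∃ δ > 0, ∀ β ∈ M.etaSet ×ˢ M.thetaSet, ε < ‖β - α‖ → δ ≤ ‖∫ x, M.score β x ∂μ‖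

/-- Condition (P2): the score exists, is continuously differentiable in the parameters, and it and
its derivative have integrable suprema over compact sets. -/
def CondP2 (μ : Measure (Fin (p + 1) → Fin d → ℝ)) : Prop :=
  M.ScoreExists μ ∧
  (∀ᵐ x ∂μ, ContDiffOn ℝ 1 (fun α => M.score α x) (M.etaSet ×ˢ M.thetaSet)) ∧
  ∀ K₁ ⊆ M.etaSet, ∀ K₂ ⊆ M.thetaSet, IsCompact K₁ → IsCompact K₂ →
    ∫⁻ x, ⨆ η ∈ K₁, ⨆ θ ∈ K₂, (‖M.score (η, θ) x‖ₑ +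
      ‖fderivWithin ℝ (fun α => M.score α x) (M.etaSet ×ˢ M.thetaSet) (η, θ)‖ₑ) ∂μ < ⊤

end Model

/-! ## Time series -/

section TimeSeries

variable {Ω : Type*} [MeasurableSpace Ω] {d : ℕ}

/-- Strict stationarity of `(X_t)_{t ∈ ℤ}`. -/
def StrictlyStationary (P : Measure Ω) (X : ℤ → Ω → Fin d → ℝ) : Prop :=
  ∀ (n : ℕ) (t : Fin n → ℤ) (τ : ℤ),
    P.map (fun ω i => X (t i + τ) ω) = P.map (fun ω i => X (t i) ω)

/-- The coefficient of absolute regularity of two `σ`-algebras: the supremum of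
`½ ∑ᵢ ∑ⱼ |P(Aᵢ ∩ Bⱼ) - P(Aᵢ) P(Bⱼ)|` over finite measurable partitions. -/
def betaCoeff (P : Measure Ω) (𝒜 ℬ : MeasurableSpace Ω) : ℝ≥0∞ :=
  ⨆ (n : ℕ) (m : ℕ) (A : Fin n → Set Ω) (B : Fin m → Set Ω)
    (_ : (∀ i, MeasurableSet[𝒜] (A i)) ∧ Pairwise (Function.onFun Disjoint A) ∧
      ⋃ i, A i = Set.univ)
    (_ : (∀ j, MeasurableSet[ℬ] (B j)) ∧ Pairwise (Function.onFun Disjoint B) ∧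
      ⋃ j, B j = Set.univ),
    ENNReal.ofReal (1 / 2 * ∑ i, ∑ j, |P.real (A i ∩ B j) - P.real (A i) * P.real (B j)|)

/-- The `β`-mixing coefficients of a time series. -/
def betaMixing (P : Measure Ω) (X : ℤ → Ω → Fin d → ℝ) (n : ℕ) : ℝ≥0∞ :=
  ⨆ t : ℤ, betaCoeff P (⨆ s ∈ Set.Iic t, MeasurableSpace.comap (X s) inferInstance)
    (⨆ s ∈ Set.Ici (t + n), MeasurableSpace.comap (X s) inferInstance)

/-- Absolute regularity (`β`-mixing). -/
def AbsolutelyRegular (P : Measure Ω) (X : ℤ → Ω → Fin d → ℝ) : Prop :=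
  Tendsto (betaMixing P X) atTop (𝓝 0)

/-- The window `(X_t, …, X_{t+p})`. -/
def window (p : ℕ) (X : ℤ → Ω → Fin d → ℝ) (t : ℤ) (ω : Ω) : Fin (p + 1) → Fin d → ℝ :=
  fun i => X (t + (i : ℕ)) ω

/-- The estimating equations of the parametric step-wise MLE from `T` time points, in the
parameters `α = (η, θ)`. A fixed number `r [e]` of terms may be left out of the sum for `[e]`. -/
def SolvesEstimatingEquation {p : ℕ} (M : Model d p) (X : ℤ → Ω → Fin d → ℝ)
    (r : M.V.EdgeClass → ℕ) (T : ℕ) (ω : Ω) (α : M.EtaSpace × M.ThetaSpace) : Prop :=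
  α ∈ M.etaSet ×ˢ M.thetaSet ∧
  (∀ j, (T : ℝ)⁻¹ • ∑ t ∈ Finset.Icc 1 T, (M.score α (window p X t ω)).1 j = 0) ∧
  (∀ q, (T : ℝ)⁻¹ • ∑ t ∈ Finset.Icc 1 (T - r q), (M.score α (window p X t ω)).2 q = 0)

end TimeSeries

end SVine

end

/-!
The estimator converges because, away from the pseudo-true value, the estimating equations have no
solution with probability tending to one. Since the estimator stays in a compact set `K` of
parameters up to small probability, it is enough to exclude solutions in compact sets that do not
contain `αstar` (`tendstoInMeasure_of_tendsto_measure_exists`), and by compactness it is enough to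
exclude them near each `β ≠ αstar` (`tendsto_measure_exists_of_isCompact`).

Near such a `β` the argument is a local uniform law of large numbers. Identification gives
`E φ_β ≠ 0`, so some block `E s` of it is nonzero. The sample mean of `s` at `β` converges to this
expectation. The oscillation of `s` over a small ball around `β` is dominated by a measurable
function whose mean is as small as desired (continuity in the parameter and dominated convergence,
`exists_small_modulus`), and the sample mean of that function converges to its mean. Hence the
sample mean of `s` cannot vanish at any parameter of the ball
(`exists_nhdsWithin_tendsto_measure_exists_sum_eq_zero`). Working block by block makes the
terms left out of the estimating equations harmless: the block for `[e]` uses the law of large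
numbers for the first `T - r [e]` windows.

The weak law of large numbers in `L¹` (`tendsto_eLpNorm_sampleMean_sub_integral`) is proved for
stationary sequences in which the covariance of `{W s ∈ A}` and `{W t ∈ A}` tends to zero as the lag
grows: for indicators by bounding the variance, and for integrable functions by density of the
simple functions, averaging being an `L¹` contraction. The windows of an absolutely regular series
have this property (`AbsolutelyRegular.pairwiseAsymptoticallyIndep_window`).

Measurability of the scores in the observation is not among the hypotheses. It follows from
identification: a Bochner integral that does not vanish is the integral of an integrable function.
-/

namespace SVine

/-! ### The weak law of large numbers under vanishing covariances -/

section LawOfLargeNumbers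

variable {Ω S E : Type*} [MeasurableSpace Ω] [MeasurableSpace S] {P : Measure Ω} {μ : Measure S}

/-- The average of `g (W 1), …, g (W n)`. -/
noncomputable def sampleMean {F : Type*} [AddCommGroup F] [Module ℝ F] (W : ℕ → Ω → S) (g : S → F)
    (n : ℕ) (ω : Ω) : F :=
  (n : ℝ)⁻¹ • ∑ t ∈ Finset.Icc 1 n, g (W t ω)

/-- A sequence is pairwise asymptotically independent when, for each event `A`, the covariance of
`{W s ∈ A}` and `{W t ∈ A}` is bounded by a null sequence evaluated at the lag `t - s`. This is the
only consequence of mixing that the weak law of large numbers needs; the bound may depend on `A`. -/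
def PairwiseAsymptoticallyIndep (P : Measure Ω) (μ : Measure S) (W : ℕ → Ω → S) : Prop :=
  ∀ A : Set S, MeasurableSet A → ∃ b : ℕ → ℝ, (∀ k, 0 ≤ b k) ∧ Tendsto b atTop (𝓝 0) ∧
    ∀ s t : ℕ, s ≤ t → |P.real (W s ⁻¹' A ∩ W t ⁻¹' A) - μ.real A ^ 2| ≤ b (t - s)

/-- A row of the matrix `b |s - t|` with `s, t ≤ n` takes each lag at most twice. The difference
`max s t - min s t` is the distance `|s - t|` of two natural numbers. -/
lemma sum_lag_le {b : ℕ → ℝ} (hb : ∀ k, 0 ≤ b k) (n s : ℕ) (hs : s ∈ Finset.Icc 1 n) :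
    ∑ t ∈ Finset.Icc 1 n, b (max s t - min s t) ≤ 2 * ∑ k ∈ Finset.range n, b k := by
  classical
  rw [Finset.mem_Icc] at hs
  rw [← Finset.sum_filter_add_sum_filter_not (Finset.Icc 1 n) (fun t => t ≤ s), two_mul]
  have key : ∀ I : Finset ℕ, (∀ t ∈ I, max s t - min s t < n) →
      Set.InjOn (fun t => max s t - min s t) I →
      ∑ t ∈ I, b (max s t - min s t) ≤ ∑ k ∈ Finset.range n, b k := by
    intro I hI hinj
    rw [← Finset.sum_image (f := b) (g := fun t => max s t - min s t) hinj]
    refine Finset.sum_le_sum_of_subset_of_nonneg ?_ fun k _ _ => hb k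
    intro k hk
    obtain ⟨t, ht, rfl⟩ := Finset.mem_image.1 hk
    exact Finset.mem_range.2 (hI t ht)
  refine add_le_add (key _ ?_ ?_) (key _ ?_ ?_)
  · intro t ht
    simp only [Finset.mem_filter, Finset.mem_Icc] at ht
    omega
  · intro t ht t' ht' h
    simp only [Finset.coe_filter, Set.mem_ofPred_eq, Finset.mem_Icc] at ht ht' h
    omega
  · intro t ht
    simp only [Finset.mem_filter, Finset.mem_Icc] at ht
    omega
  · intro t ht t' ht' h
    simp only [Finset.coe_filter, Set.mem_ofPred_eq, Finset.mem_Icc] at ht ht' h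
    omega

/-- The variance bound behind the law of large numbers: the second moment of the centred relative
frequency of `A` is at most twice the Cesàro mean of the covariance bounds. -/
lemma integral_sampleMean_indicator_sub_sq_le [IsProbabilityMeasure P] {W : ℕ → Ω → S}
    (hW : ∀ t, MeasurePreserving (W t) P μ) {A : Set S} (hA : MeasurableSet A) {b : ℕ → ℝ}
    (hb : ∀ k, 0 ≤ b k)
    (hcov : ∀ s t : ℕ, s ≤ t → |P.real (W s ⁻¹' A ∩ W t ⁻¹' A) - μ.real A ^ 2| ≤ b (t - s))
    {n : ℕ} (hn : n ≠ 0) :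
    ∫ ω, (sampleMean W (A.indicator fun _ => (1 : ℝ)) n ω - μ.real A) ^ 2 ∂P ≤
      2 * ((n : ℝ)⁻¹ * ∑ k ∈ Finset.range n, b k) := by
  have hn' : (n : ℝ) ≠ 0 := Nat.cast_ne_zero.2 hn
  set m := μ.real A with hm
  set Z : ℕ → Ω → ℝ := fun t ω => (W t ⁻¹' A).indicator (fun _ => (1 : ℝ)) ω - m with hZ
  have hmeas : ∀ t, MeasurableSet (W t ⁻¹' A) := fun t => (hW t).measurable hA
  have hPt : ∀ t, P.real (W t ⁻¹' A) = m := fun t => by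
    rw [hm, measureReal_def, measureReal_def, (hW t).measure_preimage hA.nullMeasurableSet]
  have hI : ∀ B : Set Ω, MeasurableSet B → Integrable (B.indicator fun _ => (1 : ℝ)) P :=
    fun B hB => (integrable_const 1).indicator hB
  -- `Z s * Z t` in terms of indicators, so that its mean is the covariance at lag `|s - t|`
  have hprod : ∀ s t ω, Z s ω * Z t ω =
      ((W s ⁻¹' A ∩ W t ⁻¹' A).indicator (fun _ => (1 : ℝ)) ω
        - m * (W s ⁻¹' A).indicator (fun _ => (1 : ℝ)) ω
        - m * (W t ⁻¹' A).indicator (fun _ => (1 : ℝ)) ω) + m ^ 2 := by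
    intro s t ω
    by_cases h1 : W s ω ∈ A <;> by_cases h2 : W t ω ∈ A <;>
      simp [hZ, Set.indicator, h1, h2] <;> ring
  have hi : ∀ s t, Integrable (fun ω => Z s ω * Z t ω) P := by
    intro s t
    simp_rw [hprod]
    exact ((((hI _ ((hmeas s).inter (hmeas t))).sub ((hI _ (hmeas s)).const_mul m)).sub
      ((hI _ (hmeas t)).const_mul m)).add (integrable_const _))
  have hexp : ∀ f g h : Ω → ℝ, Integrable f P → Integrable g P → Integrable h P →
      ∫ ω, (f ω - m * g ω - m * h ω + m ^ 2) ∂P =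
        ∫ ω, f ω ∂P - m * ∫ ω, g ω ∂P - m * ∫ ω, h ω ∂P + m ^ 2 := by
    intro f g h hf hg hh
    have h1 : Integrable (fun ω => f ω - m * g ω) P := hf.sub (hg.const_mul m)
    have h2 : Integrable (fun ω => f ω - m * g ω - m * h ω) P := h1.sub (hh.const_mul m)
    rw [integral_add h2 (integrable_const _), integral_sub h1 (hh.const_mul m),
      integral_sub hf (hg.const_mul m), integral_const_mul, integral_const_mul]
    simp
  have hint : ∀ s t, ∫ ω, Z s ω * Z t ω ∂P = P.real (W s ⁻¹' A ∩ W t ⁻¹' A) - m ^ 2 := by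
    intro s t
    rw [integral_congr_ae (Eventually.of_forall (hprod s t)),
      hexp _ _ _ (hI _ ((hmeas s).inter (hmeas t))) (hI _ (hmeas s)) (hI _ (hmeas t)),
      integral_indicator_const _ (hmeas s), integral_indicator_const _ (hmeas t),
      integral_indicator_const _ ((hmeas s).inter (hmeas t)), hPt, hPt]
    simp only [smul_eq_mul]
    ring
  have hmean : ∀ ω, (sampleMean W (A.indicator fun _ => (1 : ℝ)) n ω - m) ^ 2 =
      ((n : ℝ)⁻¹) ^ 2 * ∑ s ∈ Finset.Icc 1 n, ∑ t ∈ Finset.Icc 1 n, Z s ω * Z t ω := by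
    intro ω
    have : sampleMean W (A.indicator fun _ => (1 : ℝ)) n ω - m =
        (n : ℝ)⁻¹ * ∑ s ∈ Finset.Icc 1 n, Z s ω := by
      simp only [sampleMean, hZ, Finset.sum_sub_distrib, smul_eq_mul, Finset.sum_const,
        Nat.card_Icc, Nat.add_sub_cancel, nsmul_eq_mul, mul_sub]
      rw [← mul_assoc _ (n : ℝ) m, inv_mul_cancel₀ hn', one_mul]
      rfl
    rw [this, mul_pow, sq (∑ s ∈ Finset.Icc 1 n, Z s ω), Finset.sum_mul_sum]
  simp_rw [hmean]
  rw [integral_const_mul, integral_finsetSum _ fun s _ => integrable_finsetSum _ fun t _ => hi s t]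
  have hle : ∀ s ∈ Finset.Icc 1 n, ∫ ω, ∑ t ∈ Finset.Icc 1 n, Z s ω * Z t ω ∂P ≤
      2 * ∑ k ∈ Finset.range n, b k := by
    intro s hs
    rw [integral_finsetSum _ fun t _ => hi s t]
    refine le_trans (Finset.sum_le_sum fun t _ => ?_) (sum_lag_le hb n s hs)
    rw [hint]
    rcases le_total s t with h | h
    · simpa [h] using (le_abs_self _).trans (hcov s t h)
    · rw [Set.inter_comm]
      simpa [h] using (le_abs_self _).trans (hcov t s h)
  have := Finset.sum_le_sum hle
  rw [Finset.sum_const, Nat.card_Icc, Nat.add_sub_cancel, nsmul_eq_mul] at this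
  calc _ ≤ ((n : ℝ)⁻¹) ^ 2 * (n * (2 * ∑ k ∈ Finset.range n, b k)) := by gcongr
    _ = _ := by field_simp

variable [NormedAddCommGroup E] [NormedSpace ℝ E]

lemma aestronglyMeasurable_sampleMean {W : ℕ → Ω → S} (hW : ∀ t, MeasurePreserving (W t) P μ)
    {g : S → E} (hg : AEStronglyMeasurable g μ) (n : ℕ) :
    AEStronglyMeasurable (sampleMean W g n) P :=
  (Finset.aestronglyMeasurable_fun_sum _ fun t _ =>
    hg.comp_measurePreserving (hW t)).const_smul (n : ℝ)⁻¹

omit [MeasurableSpace Ω] [MeasurableSpace S] in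
lemma sampleMean_sub (W : ℕ → Ω → S) (g h : S → E) (n : ℕ) :
    sampleMean W (g - h) n = sampleMean W g n - sampleMean W h n := by
  funext ω
  simp [sampleMean, Finset.sum_sub_distrib, smul_sub]

omit [MeasurableSpace Ω] [MeasurableSpace S] in
lemma sampleMean_add (W : ℕ → Ω → S) (g h : S → E) (n : ℕ) :
    sampleMean W (g + h) n = sampleMean W g n + sampleMean W h n := by
  funext ω
  simp [sampleMean, Finset.sum_add_distrib, smul_add]

/-- By stationarity, averaging does not increase the `L¹` norm. -/
lemma eLpNorm_sampleMean_le {W : ℕ → Ω → S} (hW : ∀ t, MeasurePreserving (W t) P μ)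
    {g : S → E} (hg : AEStronglyMeasurable g μ) (n : ℕ) :
    eLpNorm (sampleMean W g n) 1 P ≤ eLpNorm g 1 μ := by
  have h1 : eLpNorm (∑ t ∈ Finset.Icc 1 n, g ∘ W t) 1 P ≤ n * eLpNorm g 1 μ := by
    refine (eLpNorm_sum_le (fun t _ => hg.comp_measurePreserving (hW t)) le_rfl).trans ?_
    rw [Finset.sum_congr rfl fun t _ => eLpNorm_comp_measurePreserving hg (hW t)]
    simp
  have h2 : sampleMean W g n = (n : ℝ)⁻¹ • ∑ t ∈ Finset.Icc 1 n, g ∘ W t := by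
    funext ω; simp [sampleMean]
  rw [h2, eLpNorm_const_smul]
  rcases eq_or_ne n 0 with rfl | hn
  · simp
  have h3 : ‖(n : ℝ)⁻¹‖ₑ * n = 1 := by
    rw [Real.enorm_of_nonneg (by positivity), ENNReal.ofReal_inv_of_pos (by positivity),
      ENNReal.ofReal_natCast]
    exact ENNReal.inv_mul_cancel (by simpa using hn) (by simp)
  calc _ ≤ ‖(n : ℝ)⁻¹‖ₑ * (n * eLpNorm g 1 μ) := by gcongr
    _ = _ := by rw [← mul_assoc, h3, one_mul]

lemma tendsto_eLpNorm_sampleMean_indicator_sub [IsProbabilityMeasure P] {W : ℕ → Ω → S}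
    (hW : ∀ t, MeasurePreserving (W t) P μ) (hmix : PairwiseAsymptoticallyIndep P μ W)
    {A : Set S} (hA : MeasurableSet A) :
    Tendsto (fun n => eLpNorm (fun ω => sampleMean W (A.indicator fun _ => (1 : ℝ)) n ω - μ.real A)
      1 P) atTop (𝓝 0) := by
  have : IsProbabilityMeasure μ := (hW 0).map_eq ▸
    Measure.isProbabilityMeasure_map (hW 0).measurable.aemeasurable
  obtain ⟨b, hb0, hb, hcov⟩ := hmix A hA
  set f : ℕ → Ω → ℝ := fun n ω => sampleMean W (A.indicator fun _ => (1 : ℝ)) n ω - μ.real A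
  have hfm : ∀ n, AEStronglyMeasurable (f n) P := fun n =>
    (aestronglyMeasurable_sampleMean hW
      (stronglyMeasurable_const.indicator hA).aestronglyMeasurable n).sub
      aestronglyMeasurable_const
  have hbound : ∀ n ω, ‖f n ω‖ ≤ 2 := by
    intro n ω
    have h1 : ‖sampleMean W (A.indicator fun _ => (1 : ℝ)) n ω‖ ≤ 1 := by
      have : ‖∑ t ∈ Finset.Icc 1 n, A.indicator (fun _ => (1 : ℝ)) (W t ω)‖ ≤ n := by
        refine (norm_sum_le_of_le _ (n := fun _ => (1 : ℝ)) fun t _ => ?_).trans (by simp)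
        exact (norm_indicator_le_norm_self _ _).trans (by simp)
      rw [sampleMean, norm_smul, norm_inv, RCLike.norm_natCast]
      exact (mul_le_mul_of_nonneg_left this (by positivity)).trans (inv_mul_le_one)
    have h2 : ‖μ.real A‖ ≤ 1 := by
      rw [Real.norm_of_nonneg measureReal_nonneg]; exact measureReal_le_one
    calc ‖f n ω‖ ≤ _ := norm_sub_le _ _
      _ ≤ 2 := by linarith
  have hfi : ∀ n, Integrable (f n) P := fun n =>
    Integrable.of_bound (hfm n) 2 (Eventually.of_forall (hbound n))
  have hfi2 : ∀ n, Integrable (fun ω => f n ω ^ 2) P := fun n => by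
    refine Integrable.of_bound ((hfm n).pow 2) 4 (Eventually.of_forall fun ω => ?_)
    rw [norm_pow]
    have := hbound n ω
    nlinarith [norm_nonneg (f n ω)]
  have hces := (hb.cesaro).const_mul 2
  rw [mul_zero] at hces
  have hreal : Tendsto (fun n => ∫ ω, ‖f n ω‖ ∂P) atTop (𝓝 0) := by
    rw [Metric.tendsto_atTop]
    intro ε hε
    obtain ⟨N, hN⟩ := (Metric.tendsto_atTop.1 hces) (ε ^ 2 / 4) (by positivity)
    refine ⟨max N 1, fun n hn => ?_⟩
    have h1 := hN n (le_trans (le_max_left _ _) hn)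
    have h2 := integral_sampleMean_indicator_sub_sq_le hW hA hb0 hcov
      (n := n) (by have := le_trans (le_max_right _ _) hn; omega)
    rw [Real.dist_eq, sub_zero] at h1 ⊢
    rw [abs_of_nonneg (integral_nonneg fun ω => norm_nonneg _)]
    -- `|y| ≤ ε / 4 + y² / ε` replaces the Cauchy–Schwarz inequality
    have h3 : ∫ ω, ‖f n ω‖ ∂P ≤ ∫ ω, (ε / 4 + ε⁻¹ * f n ω ^ 2) ∂P := by
      refine integral_mono (hfi n).norm ((integrable_const _).add ((hfi2 n).const_mul _)) ?_
      intro ω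
      have h4 : ‖f n ω‖ ≤ ε / 4 + ε⁻¹ * ‖f n ω‖ ^ 2 := by
        have h5 : ε / 4 + ε⁻¹ * ‖f n ω‖ ^ 2 - ‖f n ω‖ = ε⁻¹ * (‖f n ω‖ - ε / 2) ^ 2 := by
          field_simp; ring
        have : 0 ≤ ε⁻¹ * (‖f n ω‖ - ε / 2) ^ 2 := by positivity
        linarith
      simpa using h4
    rw [integral_add (integrable_const _) ((hfi2 n).const_mul _), integral_const_mul] at h3
    have h6 : ε⁻¹ * ∫ ω, f n ω ^ 2 ∂P < ε⁻¹ * (ε ^ 2 / 4) := by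
      refine mul_lt_mul_of_pos_left (lt_of_le_of_lt h2 ((le_abs_self _).trans_lt h1))
        (by positivity)
    have h7 : ε⁻¹ * (ε ^ 2 / 4) = ε / 4 := by field_simp
    simp only [integral_const, probReal_univ, smul_eq_mul, one_mul] at h3
    linarith
  have : ∀ n, eLpNorm (f n) 1 P = ENNReal.ofReal (∫ ω, ‖f n ω‖ ∂P) := fun n => by
    rw [eLpNorm_one_eq_lintegral_enorm, ofReal_integral_norm_eq_lintegral_enorm (hfi n)]
  change Tendsto (fun n => eLpNorm (f n) 1 P) atTop (𝓝 0)
  simp_rw [this]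
  simpa using ENNReal.tendsto_ofReal hreal

/-- The weak law of large numbers in `L¹` for stationary, pairwise asymptotically independent
sequences. The class of functions for which it holds contains the indicators, is a vector space and
is closed in `L¹`. -/
theorem tendsto_eLpNorm_sampleMean_sub_integral [CompleteSpace E] [IsProbabilityMeasure P]
    {W : ℕ → Ω → S}
    (hW : ∀ t, MeasurePreserving (W t) P μ) (hmix : PairwiseAsymptoticallyIndep P μ W)
    {g : S → E} (hg : Integrable g μ) :
    Tendsto (fun n => eLpNorm (fun ω => sampleMean W g n ω - ∫ x, g x ∂μ) 1 P) atTop (𝓝 0) := by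
  have : IsProbabilityMeasure μ := (hW 0).map_eq ▸
    Measure.isProbabilityMeasure_map (hW 0).measurable.aemeasurable
  have hind : ∀ (c : E) (A : Set S), MeasurableSet A →
      Tendsto (fun n => eLpNorm (fun ω => sampleMean W (A.indicator fun _ => c) n ω -
        ∫ x, A.indicator (fun _ => c) x ∂μ) 1 P) atTop (𝓝 0) := by
    intro c A hA
    have h0 : ∀ n, (fun ω => sampleMean W (A.indicator fun _ => c) n ω -
        ∫ x, A.indicator (fun _ => c) x ∂μ) =
        fun ω => (sampleMean W (A.indicator fun _ => (1 : ℝ)) n ω - μ.real A) • c := by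
      intro n
      funext ω
      rw [integral_indicator_const _ hA, sub_smul, sampleMean, sampleMean, smul_assoc,
        Finset.sum_smul]
      congr 3 with t
      by_cases h : W t ω ∈ A <;> simp [h]
    have h1 := ENNReal.Tendsto.mul_const (b := ‖c‖ₑ)
      (tendsto_eLpNorm_sampleMean_indicator_sub hW hmix hA) (Or.inr (by simp))
    rw [zero_mul] at h1
    refine h1.congr fun n => ?_
    rw [h0, eLpNorm_one_eq_lintegral_enorm, eLpNorm_one_eq_lintegral_enorm]
    simp_rw [enorm_smul]
    rw [lintegral_mul_const' _ _ (by simp)]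
  -- replacing `f` by `h` costs at most `2 ‖f - h‖₁`, uniformly in `n`
  have hstep : ∀ (f h : S → E), Integrable f μ → Integrable h μ → ∀ n,
      eLpNorm (fun ω => sampleMean W f n ω - ∫ x, f x ∂μ) 1 P ≤
        eLpNorm (fun ω => sampleMean W h n ω - ∫ x, h x ∂μ) 1 P + 2 * eLpNorm (f - h) 1 μ := by
    intro f h hf hh n
    have hfh : Integrable (f - h) μ := hf.sub hh
    have e : (fun ω => sampleMean W f n ω - ∫ x, f x ∂μ) =
        (fun ω => sampleMean W h n ω - ∫ x, h x ∂μ) +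
          (sampleMean W (f - h) n - fun _ => ∫ x, (f - h) x ∂μ) := by
      funext ω
      simp only [sampleMean_sub, Pi.add_apply, Pi.sub_apply, integral_sub hf hh]
      abel
    have m1 := (aestronglyMeasurable_sampleMean hW hh.1 n).sub
      (aestronglyMeasurable_const (b := ∫ x, h x ∂μ))
    have m2 := aestronglyMeasurable_sampleMean hW hfh.1 n
    have m3 : AEStronglyMeasurable (fun _ : Ω => ∫ x, (f - h) x ∂μ) P := aestronglyMeasurable_const
    rw [e]
    refine (eLpNorm_add_le m1 (m2.sub m3) le_rfl).trans (add_le_add le_rfl ?_)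
    refine (eLpNorm_sub_le m2 m3 le_rfl).trans ?_
    rw [two_mul]
    refine add_le_add (eLpNorm_sampleMean_le hW hfh.1 n) ?_
    rw [eLpNorm_one_eq_lintegral_enorm, eLpNorm_one_eq_lintegral_enorm, lintegral_const,
      measure_univ, mul_one]
    exact enorm_integral_le_lintegral_enorm _
  rw [ENNReal.tendsto_nhds_zero]
  intro ε hε
  have hε4 : ε / 4 ≠ 0 := by simpa using hε.ne'
  obtain ⟨h, hclose, hhi, hconv⟩ := (memLp_one_iff_integrable.2 hg).induction_dense (by simp)
    (P := fun h => Integrable h μ ∧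
      Tendsto (fun n => eLpNorm (fun ω => sampleMean W h n ω - ∫ x, h x ∂μ) 1 P) atTop (𝓝 0))
    (fun c A hA _ δ _ => ⟨A.indicator fun _ => c, by simp,
      (integrable_const c).indicator hA, hind c A hA⟩)
    (by
      rintro f h ⟨hf, hf'⟩ ⟨hh, hh'⟩
      refine ⟨hf.add hh, ?_⟩
      have := hf'.add hh'
      rw [add_zero] at this
      refine tendsto_of_tendsto_of_tendsto_of_le_of_le tendsto_const_nhds this (fun _ => zero_le)
        fun n => ?_
      have e : (fun ω => sampleMean W (f + h) n ω - ∫ x, (f + h) x ∂μ) =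
          (fun ω => sampleMean W f n ω - ∫ x, f x ∂μ) +
            fun ω => sampleMean W h n ω - ∫ x, h x ∂μ := by
        funext ω
        simp only [sampleMean_add, Pi.add_apply, integral_add hf hh]
        abel
      simp only [e]
      exact eLpNorm_add_le
        ((aestronglyMeasurable_sampleMean hW hf.1 n).sub aestronglyMeasurable_const)
        ((aestronglyMeasurable_sampleMean hW hh.1 n).sub aestronglyMeasurable_const) le_rfl)
    (fun f hf => hf.1.1) hε4
  filter_upwards [ENNReal.tendsto_nhds_zero.1 hconv (ε / 2) (ENNReal.half_pos hε.ne')] with n hn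
  calc _ ≤ _ := hstep g h hg hhi n
    _ ≤ ε / 2 + 2 * (ε / 4) := by gcongr
    _ = ε := by
      have : (2 : ℝ≥0∞) * (ε / 4) = ε / 2 := by
        rw [show (4 : ℝ≥0∞) = 2 * 2 by norm_num, div_eq_mul_inv, div_eq_mul_inv,
          ENNReal.mul_inv (by simp) (by simp), mul_comm ε, ← mul_assoc, ← mul_assoc,
          ENNReal.mul_inv_cancel (by simp) (by simp), one_mul, mul_comm]
      rw [this, ENNReal.add_halves]

lemma tendstoInMeasure_sampleMean [CompleteSpace E] [IsProbabilityMeasure P] {W : ℕ → Ω → S}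
    (hW : ∀ t, MeasurePreserving (W t) P μ) (hmix : PairwiseAsymptoticallyIndep P μ W)
    {g : S → E} (hg : Integrable g μ) :
    TendstoInMeasure P (sampleMean W g) atTop fun _ => ∫ x, g x ∂μ :=
  tendstoInMeasure_of_tendsto_eLpNorm one_ne_zero (aestronglyMeasurable_sampleMean hW hg.1)
    aestronglyMeasurable_const (tendsto_eLpNorm_sampleMean_sub_integral hW hmix hg)

end LawOfLargeNumbers

/-! ### Estimating equations without asymptotic solutions -/

section EstimatingEquations

variable {Ω S B E : Type*} [MeasurableSpace Ω] [MeasurableSpace S] {P : Measure Ω} {μ : Measure S}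
  [PseudoMetricSpace B] [NormedAddCommGroup E]

/-- Near `β`, the oscillation of a dominated family `s` of functions that is continuous in its
parameter has a measurable majorant of arbitrarily small mean. The majorant is a supremum over a
countable dense set of parameters, which secures its measurability; the dominating function `G` need
not be measurable. -/
lemma exists_small_modulus {K : Set B} (hK : TopologicalSpace.IsSeparable K) {s : B → S → E}
    (hm : ∀ β ∈ K, AEStronglyMeasurable (s β) μ)
    (hc : ∀ᵐ x ∂μ, ContinuousOn (fun β => s β x) K) {G : S → ℝ≥0∞}
    (hG : ∀ β ∈ K, ∀ x, ‖s β x‖ₑ ≤ G x) (hGi : ∫⁻ x, G x ∂μ ≠ ∞) {β : B} (hβ : β ∈ K)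
    {c : ℝ≥0∞} (hc0 : 0 < c) :
    ∃ r > 0, ∃ Δ : S → ℝ≥0∞, AEMeasurable Δ μ ∧ ∫⁻ x, Δ x ∂μ < c ∧
      ∀ᵐ x ∂μ, ∀ β' ∈ K ∩ Metric.ball β r, ‖s β' x - s β x‖ₑ ≤ Δ x := by
  obtain ⟨D, hDK, hDc, hKD⟩ := hK.exists_countable_dense_subset
  set r : ℕ → ℝ := fun n => 1 / ((n : ℝ) + 1) with hr
  have hr0 : ∀ n, 0 < r n := fun n => Nat.one_div_pos_of_nat
  set Δ : ℕ → S → ℝ≥0∞ := fun n x => ⨆ β' ∈ D ∩ Metric.ball β (r n), ‖s β' x - s β x‖ₑ with hΔ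
  have hmeas : ∀ n, AEMeasurable (Δ n) μ := fun n =>
    AEMeasurable.biSup _ (hDc.mono Set.inter_subset_left) fun β' hβ' =>
      ((hm β' (hDK hβ'.1)).sub (hm β hβ)).enorm
  have hdom : ∀ n, Δ n ≤ᵐ[μ] fun x => 2 * G x := fun n => Eventually.of_forall fun x =>
    iSup₂_le fun β' hβ' => by
      simp only [two_mul]
      exact (enorm_sub_le).trans (add_le_add (hG β' (hDK hβ'.1) x) (hG β hβ x))
  have hlim : ∀ᵐ x ∂μ, Tendsto (fun n => Δ n x) atTop (𝓝 0) := by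
    filter_upwards [hc] with x hx
    rw [ENNReal.tendsto_nhds_zero]
    intro ε hε
    have h1 : ∀ᶠ β' in 𝓝[K] β, edist (s β' x) (s β x) ≤ ε :=
      (hx β hβ).eventually (Metric.closedEBall_mem_nhds _ hε)
    obtain ⟨ρ, hρ, h2⟩ := Metric.mem_nhdsWithin_iff.1 h1
    obtain ⟨N, hN⟩ := exists_nat_one_div_lt hρ
    filter_upwards [eventually_ge_atTop N] with n hn
    refine iSup₂_le fun β' hβ' => ?_
    rw [← edist_eq_enorm_sub]
    refine h2 ⟨Metric.ball_subset_ball ?_ hβ'.2, hDK hβ'.1⟩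
    exact (Nat.one_div_le_one_div hn).trans hN.le
  have hint := tendsto_lintegral_of_dominated_convergence' (fun x => 2 * G x) hmeas hdom
    (by rw [lintegral_const_mul' _ _ (by simp)]; exact ENNReal.mul_ne_top (by simp) hGi) hlim
  rw [lintegral_zero] at hint
  obtain ⟨n, hn⟩ := (hint.eventually_lt_const hc0).exists
  refine ⟨r n, hr0 n, Δ n, hmeas n, hn, ?_⟩
  filter_upwards [hc] with x hx β' hβ'
  -- the bound holds on `D` by definition and extends by continuity to all of `K` in the ball
  have hcl : β' ∈ closure (D ∩ Metric.ball β (r n)) := by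
    rw [Set.inter_comm]
    exact Metric.isOpen_ball.inter_closure ⟨hβ'.2, hKD hβ'.1⟩
  have hcont : ContinuousWithinAt (fun b => ‖s b x - s β x‖ₑ) (D ∩ Metric.ball β (r n)) β' :=
    (((hx β' hβ'.1).mono (Set.inter_subset_left.trans hDK)).sub continuousWithinAt_const).enorm
  exact hcont.closure_le hcl continuousWithinAt_const fun b hb =>
    le_iSup₂ (f := fun b (_ : b ∈ D ∩ Metric.ball β (r n)) => ‖s b x - s β x‖ₑ) b hb

/-- Where the mean of `s β` does not vanish, the estimating equation asymptotically has no solution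
in a whole neighbourhood of `β`: the sample mean of `s β` is close to its nonzero expectation, and
the sample mean of the local modulus of continuity is close to its small expectation. -/
lemma exists_nhdsWithin_tendsto_measure_exists_sum_eq_zero [IsProbabilityMeasure P]
    [NormedSpace ℝ E] [CompleteSpace E] {W : ℕ → Ω → S} (hW : ∀ t, MeasurePreserving (W t) P μ)
    (hmix : PairwiseAsymptoticallyIndep P μ W)
    {K : Set B} (hK : TopologicalSpace.IsSeparable K) {s : B → S → E}
    (hm : ∀ β ∈ K, AEStronglyMeasurable (s β) μ)
    (hc : ∀ᵐ x ∂μ, ContinuousOn (fun β => s β x) K) {G : S → ℝ≥0∞}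
    (hG : ∀ β ∈ K, ∀ x, ‖s β x‖ₑ ≤ G x) (hGi : ∫⁻ x, G x ∂μ ≠ ∞) {β : B} (hβ : β ∈ K)
    (hne : ∫ x, s β x ∂μ ≠ 0) :
    ∃ U ∈ 𝓝[K] β, Tendsto
      (fun n => P {ω | ∃ β' ∈ U, ∑ t ∈ Finset.Icc 1 n, s β' (W t ω) = 0}) atTop (𝓝 0) := by
  have hsi : Integrable (s β) μ := not_imp_comm.1 integral_undef hne
  set v := ∫ x, s β x ∂μ with hv
  have hδ : 0 < ‖v‖ / 3 := by have := norm_pos_iff.2 hne; positivity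
  obtain ⟨r, hr, Δ, hΔm, hΔi, hΔ⟩ := exists_small_modulus hK hm hc hG hGi hβ
    (ENNReal.ofReal_pos.2 hδ)
  have hΔi' : ∫⁻ x, Δ x ∂μ ≠ ∞ := (hΔi.trans ENNReal.ofReal_lt_top).ne
  have hDi : Integrable (fun x => (Δ x).toReal) μ := integrable_toReal_of_lintegral_ne_top hΔm hΔi'
  have hfin : ∀ᵐ x ∂μ, Δ x < ∞ := ae_lt_top' hΔm hΔi'
  have hDlt : ∫ x, (Δ x).toReal ∂μ < ‖v‖ / 3 := by
    rw [integral_toReal hΔm hfin]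
    exact (ENNReal.lt_ofReal_iff_toReal_lt hΔi').1 hΔi
  have h1 := tendstoInMeasure_sampleMean hW hmix hsi _ (ENNReal.ofReal_pos.2 hδ)
  have h2 := tendstoInMeasure_sampleMean hW hmix hDi _ (ENNReal.ofReal_pos.2 hδ)
  have hgood : ∀ᵐ ω ∂P, ∀ t, (∀ β' ∈ K ∩ Metric.ball β r,
      ‖s β' (W t ω) - s β (W t ω)‖ₑ ≤ Δ (W t ω)) ∧ Δ (W t ω) < ∞ :=
    ae_all_iff.2 fun t => (hW t).quasiMeasurePreserving.ae (hΔ.and hfin)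
  refine ⟨K ∩ Metric.ball β r, inter_mem_nhdsWithin _ (Metric.ball_mem_nhds _ hr), ?_⟩
  have h12 := h1.add h2
  rw [add_zero] at h12
  refine tendsto_of_tendsto_of_tendsto_of_le_of_le tendsto_const_nhds h12 (fun _ => zero_le)
    fun n => ?_
  refine le_trans (measure_mono_ae ?_) (measure_union_le _ _)
  filter_upwards [hgood] with ω hω
  rintro ⟨β', hβ', hsum⟩
  -- If both sample means are within `‖v‖ / 3` of their expectations, a solution `β'` in the ball
  -- leads to `‖v‖ < ‖v‖`.
  by_contra hcon
  have hcon' : ¬ (_ ∨ _) := hcon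
  rw [not_or] at hcon'
  obtain ⟨c1, c2⟩ := hcon'
  have c1' : edist (sampleMean W (s β) n ω) v < ENNReal.ofReal (‖v‖ / 3) := not_le.1 c1
  have c2' : edist (sampleMean W (fun x => (Δ x).toReal) n ω) (∫ x, (Δ x).toReal ∂μ) <
    ENNReal.ofReal (‖v‖ / 3) := not_le.1 c2
  rw [edist_lt_ofReal, dist_eq_norm] at c1' c2'
  -- the sample mean at `β'` vanishes, so the one at `β` is bounded by the mean oscillation
  have hmean : ‖sampleMean W (s β) n ω‖ ≤ sampleMean W (fun x => (Δ x).toReal) n ω := by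
    have h0 : sampleMean W (s β) n ω =
        (n : ℝ)⁻¹ • ∑ t ∈ Finset.Icc 1 n, (s β (W t ω) - s β' (W t ω)) := by
      rw [Finset.sum_sub_distrib, hsum, sub_zero]; rfl
    rw [h0, norm_smul, norm_inv, RCLike.norm_natCast, sampleMean, smul_eq_mul]
    refine mul_le_mul_of_nonneg_left (norm_sum_le_of_le _ fun t _ => ?_) (by positivity)
    have := ENNReal.toReal_mono (hω t).2.ne ((hω t).1 β' hβ')
    rwa [toReal_enorm, norm_sub_rev] at this
  have t1 : ‖v‖ ≤ ‖sampleMean W (s β) n ω‖ + ‖sampleMean W (s β) n ω - v‖ := by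
    simpa [norm_sub_rev] using norm_le_insert' v (sampleMean W (s β) n ω)
  have t2 := (le_abs_self _).trans_lt c2'
  linarith

/-- Asymptotic absence of solutions is a local property, which passes to compact sets. -/
lemma tendsto_measure_exists_of_isCompact {Q : ℕ → Ω → B → Prop} {K : Set B} (hK : IsCompact K)
    (h : ∀ β ∈ K, ∃ U ∈ 𝓝[K] β, Tendsto (fun T => P {ω | ∃ β' ∈ U, Q T ω β'}) atTop (𝓝 0)) :
    Tendsto (fun T => P {ω | ∃ β ∈ K, Q T ω β}) atTop (𝓝 0) := by
  refine hK.induction_on (p := fun U =>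
    Tendsto (fun T => P {ω | ∃ β ∈ U, Q T ω β}) atTop (𝓝 0)) (by simp) ?_ ?_ h
  · intro U U' hUU' hU'
    refine tendsto_of_tendsto_of_tendsto_of_le_of_le tendsto_const_nhds hU' (fun _ => zero_le)
      fun T => measure_mono ?_
    rintro ω ⟨β, hβ, hQ⟩
    exact ⟨β, hUU' hβ, hQ⟩
  · intro U U' hU hU'
    have := hU.add hU'
    rw [add_zero] at this
    refine tendsto_of_tendsto_of_tendsto_of_le_of_le tendsto_const_nhds this (fun _ => zero_le)
      fun T => le_trans (measure_mono ?_) (measure_union_le _ _)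
    rintro ω ⟨β, hβ | hβ, hQ⟩
    exacts [Or.inl ⟨β, hβ, hQ⟩, Or.inr ⟨β, hβ, hQ⟩]

/-- A tight sequence that satisfies `Q` with probability tending to one converges in probability to
`β₀` when, asymptotically, `Q` has no solutions in compact sets that do not contain `β₀`. Neither
`est` nor `Q` needs to be measurable, since outer measures are subadditive. -/
lemma tendstoInMeasure_of_tendsto_measure_exists {Q : ℕ → Ω → B → Prop} {Θ : Set B} {β₀ : B}
    {est : ℕ → Ω → B} (hsol : Tendsto (fun T => P {ω | ¬ Q T ω (est T ω)}) atTop (𝓝 0))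
    (htight : ∀ δ : ℝ≥0∞, 0 < δ → ∃ K ⊆ Θ, IsCompact K ∧ ∀ᶠ T in atTop, P {ω | est T ω ∉ K} ≤ δ)
    (h : ∀ K ⊆ Θ, IsCompact K → β₀ ∉ K → Tendsto (fun T => P {ω | ∃ β ∈ K, Q T ω β}) atTop (𝓝 0)) :
    TendstoInMeasure P est atTop fun _ => β₀ := by
  intro ε hε
  rw [ENNReal.tendsto_nhds_zero]
  intro δ hδ
  obtain ⟨K, hKΘ, hK, hKT⟩ := htight (δ / 2) (ENNReal.half_pos hδ.ne')
  have hclosed : IsClosed {β : B | ε ≤ edist β β₀} :=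
    isClosed_le continuous_const (continuous_id.edist continuous_const)
  have hlim := hsol.add (h (K ∩ {β | ε ≤ edist β β₀}) (Set.inter_subset_left.trans hKΘ)
    (hK.inter_right hclosed) (fun hβ => hε.not_ge (by simpa using hβ.2)))
  rw [add_zero] at hlim
  filter_upwards [hKT, ENNReal.tendsto_nhds_zero.1 hlim (δ / 2) (ENNReal.half_pos hδ.ne')]
    with T hT1 hT2
  calc P {ω | ε ≤ edist (est T ω) β₀}
      ≤ P ({ω | est T ω ∉ K} ∪ ({ω | ¬ Q T ω (est T ω)} ∪
          {ω | ∃ β ∈ K ∩ {β | ε ≤ edist β β₀}, Q T ω β})) := by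
        refine measure_mono fun ω hω => ?_
        by_cases h1 : est T ω ∈ K
        · by_cases h2 : Q T ω (est T ω)
          · exact Or.inr (Or.inr ⟨_, ⟨h1, hω⟩, h2⟩)
          · exact Or.inr (Or.inl h2)
        · exact Or.inl h1
    _ ≤ δ / 2 + δ / 2 := (measure_union_le _ _).trans
        (add_le_add hT1 ((measure_union_le _ _).trans hT2))
    _ = δ := ENNReal.add_halves δ

end EstimatingEquations

/-! ### Windows of an absolutely regular series -/

section Windows

lemma ofReal_abs_cov_le_betaCoeff_of_partition {Ω : Type*} {𝒜 ℬ : MeasurableSpace Ω}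
    [MeasurableSpace Ω] {P : Measure Ω} {n m : ℕ} {A : Fin n → Set Ω} {B : Fin m → Set Ω}
    (hA : (∀ i, MeasurableSet[𝒜] (A i)) ∧ Pairwise (Function.onFun Disjoint A) ∧
      ⋃ i, A i = Set.univ)
    (hB : (∀ j, MeasurableSet[ℬ] (B j)) ∧ Pairwise (Function.onFun Disjoint B) ∧
      ⋃ j, B j = Set.univ) (i : Fin n) (j : Fin m) :
    ENNReal.ofReal (1 / 2 * |P.real (A i ∩ B j) - P.real (A i) * P.real (B j)|) ≤
      betaCoeff P 𝒜 ℬ := by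
  have h1 : ENNReal.ofReal (1 / 2 * ∑ i, ∑ j, |P.real (A i ∩ B j) - P.real (A i) * P.real (B j)|) ≤
      betaCoeff P 𝒜 ℬ := by
    unfold betaCoeff
    exact le_iSup_of_le n <| le_iSup_of_le m <| le_iSup_of_le A <| le_iSup_of_le B <|
      le_iSup_of_le hA <| le_iSup_of_le hB le_rfl
  refine le_trans (ENNReal.ofReal_le_ofReal ?_) h1
  refine mul_le_mul_of_nonneg_left ?_ (by norm_num)
  have h2 := Finset.single_le_sum
    (f := fun j => |P.real (A i ∩ B j) - P.real (A i) * P.real (B j)|)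
    (fun j _ => abs_nonneg _) (Finset.mem_univ j)
  have h3 := Finset.single_le_sum
    (f := fun i => ∑ j, |P.real (A i ∩ B j) - P.real (A i) * P.real (B j)|)
    (fun i _ => Finset.sum_nonneg fun j _ => abs_nonneg _) (Finset.mem_univ i)
  exact h2.trans h3

lemma partition_pair {Ω : Type*} {𝒞 : MeasurableSpace Ω} {C : Set Ω} (hC : MeasurableSet[𝒞] C) :
    (∀ i, MeasurableSet[𝒞] ((![C, Cᶜ] : Fin 2 → Set Ω) i)) ∧
      Pairwise (Function.onFun Disjoint (![C, Cᶜ] : Fin 2 → Set Ω)) ∧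
      ⋃ i, (![C, Cᶜ] : Fin 2 → Set Ω) i = Set.univ := by
  refine ⟨fun i => ?_, fun i j hij => ?_, ?_⟩
  · fin_cases i
    exacts [hC, hC.compl]
  · fin_cases i <;> fin_cases j
    · exact absurd rfl hij
    · exact disjoint_compl_right
    · exact disjoint_compl_left
    · exact absurd rfl hij
  · ext ω
    simp [Fin.exists_fin_two, em]

/-- The partitions `{A, Aᶜ}` and `{B, Bᶜ}` show that absolute regularity controls covariances of
events. -/
lemma ofReal_abs_cov_le_betaCoeff {Ω : Type*} {𝒜 ℬ : MeasurableSpace Ω} [MeasurableSpace Ω]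
    {P : Measure Ω} {A B : Set Ω} (hA : MeasurableSet[𝒜] A) (hB : MeasurableSet[ℬ] B) :
    ENNReal.ofReal (1 / 2 * |P.real (A ∩ B) - P.real A * P.real B|) ≤ betaCoeff P 𝒜 ℬ := by
  have h := ofReal_abs_cov_le_betaCoeff_of_partition (P := P) (partition_pair hA)
    (partition_pair hB) 0 0
  simpa only [Matrix.cons_val_zero] using h

lemma measurable_window_of_le {Ω : Type*} {m : MeasurableSpace Ω} {d p : ℕ}
    {X : ℤ → Ω → Fin d → ℝ} {t : ℤ}
    (h : ∀ i : Fin (p + 1), MeasurableSpace.comap (X (t + (i : ℕ))) inferInstance ≤ m) :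
    Measurable[m] (window p X t) :=
  measurable_pi_lambda _ fun i => (comap_measurable _).mono (h i) le_rfl

variable {Ω : Type*} [MeasurableSpace Ω] {P : Measure Ω} {d : ℕ} {X : ℤ → Ω → Fin d → ℝ}

lemma measurable_window (hX : ∀ t, Measurable (X t)) (p : ℕ) (t : ℤ) : Measurable (window p X t) :=
  measurable_window_of_le fun _ => (hX _).comap_le

lemma StrictlyStationary.measurePreserving_window (hstat : StrictlyStationary P X)
    (hX : ∀ t, Measurable (X t)) (p : ℕ) (t : ℤ) :
    MeasurePreserving (window p X t) P (P.map (window p X 1)) := by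
  refine ⟨measurable_window hX p t, ?_⟩
  have h := hstat (p + 1) (fun i => 1 + ((i : ℕ) : ℤ)) (t - 1)
  have e : (fun ω (i : Fin (p + 1)) => X (1 + ((i : ℕ) : ℤ) + (t - 1)) ω) = window p X t := by
    funext ω i
    rw [window, show 1 + ((i : ℕ) : ℤ) + (t - 1) = t + (i : ℕ) by ring]
  rw [e] at h
  exact h

/-- The windows of an absolutely regular series are asymptotically independent: windows at lag
`k ≥ p` depend on pieces of the series that are `k - p` time steps apart. -/
lemma AbsolutelyRegular.pairwiseAsymptoticallyIndep_window [IsProbabilityMeasure P]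
    (hreg : AbsolutelyRegular P X) (hstat : StrictlyStationary P X)
    (hX : ∀ t, Measurable (X t)) (p : ℕ) :
    PairwiseAsymptoticallyIndep P (P.map (window p X 1)) (fun t : ℕ => window p X t) := by
  intro A hA
  have hmean : ∀ t : ℤ, P.real (window p X t ⁻¹' A) = (P.map (window p X 1)).real A := fun t => by
    rw [measureReal_def, measureReal_def,
      (hstat.measurePreserving_window hX p t).measure_preimage hA.nullMeasurableSet]
  have hone : ∀ s t : ℕ, |P.real (window p X s ⁻¹' A ∩ window p X t ⁻¹' A) -
      (P.map (window p X 1)).real A ^ 2| ≤ 1 := by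
    intro s t
    have h1 : (P.map (window p X 1)).real A ≤ 1 := hmean 1 ▸ measureReal_le_one
    have h2 : 0 ≤ (P.map (window p X 1)).real A := measureReal_nonneg
    have h3 := pow_le_one₀ h2 h1 (n := 2)
    have h4 := sq_nonneg ((P.map (window p X 1)).real A)
    have h5 : P.real (window p X s ⁻¹' A ∩ window p X t ⁻¹' A) ≤ 1 := measureReal_le_one
    have h6 : 0 ≤ P.real (window p X s ⁻¹' A ∩ window p X t ⁻¹' A) := measureReal_nonneg
    exact abs_le.2 ⟨by linarith, by linarith⟩
  -- For lags below `p` the windows overlap and only the trivial bound `1` is available. The minimum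
  -- with `1` keeps the bound finite before it is converted to a real number.
  refine ⟨fun k => if k < p then 1 else (min 1 (2 * betaMixing P X (k - p))).toReal,
    fun k => by dsimp only; split_ifs <;> positivity, ?_, fun s t hst => ?_⟩
  · have h0 : Tendsto (betaMixing P X) atTop (𝓝 0) := hreg
    have h1 := h0.comp (tendsto_sub_atTop_nat p)
    have h2 := ENNReal.Tendsto.const_mul (a := 2) h1 (Or.inr (by simp))
    have h3 := (tendsto_const_nhds (x := (1 : ℝ≥0∞))).min h2
    rw [mul_zero, min_eq_right zero_le] at h3
    refine ((ENNReal.tendsto_toReal ENNReal.zero_ne_top).comp h3).congr' ?_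
    filter_upwards [eventually_ge_atTop p] with k hk
    simp [not_lt.2 hk]
  · dsimp only
    split_ifs with hk
    · exact hone s t
    · have hpast : MeasurableSet[⨆ u ∈ Set.Iic ((s : ℤ) + p),
          MeasurableSpace.comap (X u) inferInstance] (window p X s ⁻¹' A) := by
        refine measurable_window_of_le (fun i => ?_) hA
        refine le_iSup₂_of_le (f := fun u (_ : u ∈ Set.Iic ((s : ℤ) + p)) =>
          MeasurableSpace.comap (X u) inferInstance) _ ?_ le_rfl
        have := i.2
        simp only [Set.mem_Iic]
        omega
      have hfut : MeasurableSet[⨆ u ∈ Set.Ici ((s : ℤ) + p + ((t - s - p : ℕ) : ℤ)),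
          MeasurableSpace.comap (X u) inferInstance] (window p X t ⁻¹' A) := by
        refine measurable_window_of_le (fun i => ?_) hA
        refine le_iSup₂_of_le (f := fun u (_ : u ∈ Set.Ici ((s : ℤ) + p + ((t - s - p : ℕ) : ℤ))) =>
          MeasurableSpace.comap (X u) inferInstance) _ ?_ le_rfl
        simp only [Set.mem_Ici]
        omega
      have h1 := (ofReal_abs_cov_le_betaCoeff (P := P) hpast hfut).trans
        (le_iSup (fun u : ℤ => betaCoeff P
          (⨆ v ∈ Set.Iic u, MeasurableSpace.comap (X v) inferInstance)
          (⨆ v ∈ Set.Ici (u + ((t - s - p : ℕ) : ℤ)),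
            MeasurableSpace.comap (X v) inferInstance)) ((s : ℤ) + p))
      rw [hmean, hmean, ← sq] at h1
      rw [← ENNReal.ofReal_le_iff_le_toReal (by simp)]
      refine le_min (by simpa using ENNReal.ofReal_le_ofReal (hone s t)) ?_
      calc _ = 2 * ENNReal.ofReal (1 / 2 * _) := by
            rw [← ENNReal.ofReal_ofNat 2, ← ENNReal.ofReal_mul (by norm_num)]
            congr 1
            ring
        _ ≤ _ := mul_le_mul_right h1 2

end Windows

/-! ### Scores of the vine copula model -/

section Consistency

namespace Model

variable {d p : ℕ} (M : Model d p)

/-- The product norm dominates each block of the score. -/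
lemma enorm_fst_apply_le (v : M.EtaSpace × M.ThetaSpace) (j : Fin d) : ‖v.1 j‖ₑ ≤ ‖v‖ₑ :=
  enorm_le_iff_norm_le.2 ((norm_le_pi_norm v.1 j).trans (norm_fst_le v))

lemma enorm_snd_apply_le (v : M.EtaSpace × M.ThetaSpace) (q : M.V.EdgeClass) :
    ‖v.2 q‖ₑ ≤ ‖v‖ₑ :=
  enorm_le_iff_norm_le.2 ((norm_le_pi_norm v.2 q).trans (norm_snd_le v))

variable {M} {μ : Measure (Fin (p + 1) → Fin d → ℝ)} {αstar : M.EtaSpace × M.ThetaSpace}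

/-- Identification forces `E φ_β ≠ 0` away from the pseudo-true value. -/
lemma CondP1.integral_score_ne_zero (h : M.CondP1 μ αstar) {β : M.EtaSpace × M.ThetaSpace}
    (hβ : β ∈ M.etaSet ×ˢ M.thetaSet) (hne : β ≠ αstar) : ∫ x, M.score β x ∂μ ≠ 0 := by
  have hpos : 0 < ‖β - αstar‖ := norm_pos_iff.2 (sub_ne_zero.2 hne)
  obtain ⟨δ, hδ, hle⟩ := h.2 (‖β - αstar‖ / 2) (half_pos hpos)
  exact norm_pos_iff.1 (hδ.trans_le (hle β hβ (half_lt_self hpos)))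

/-- The scores are integrable, in particular measurable in the observation: the Bochner integral of
a non-integrable function vanishes, whereas `E φ_β ≠ 0` for `β ≠ αstar`. -/
lemma CondP1.integrable_score (h : M.CondP1 μ αstar) (hstar : M.IsPseudoTrue μ αstar)
    {β : M.EtaSpace × M.ThetaSpace} (hβ : β ∈ M.etaSet ×ˢ M.thetaSet) :
    Integrable (M.score β) μ := by
  by_cases hne : β = αstar
  · exact hne ▸ hstar.1
  · exact not_imp_comm.1 integral_undef (h.integral_score_ne_zero hβ hne)

/-- On a compact set `K` of parameters all scores are dominated by one function with finite
integral, obtained from the product of the two projections of `K`. -/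
lemma CondP2.exists_envelope (h : M.CondP2 μ) {K : Set (M.EtaSpace × M.ThetaSpace)}
    (hKsub : K ⊆ M.etaSet ×ˢ M.thetaSet) (hK : IsCompact K) :
    ∃ G : (Fin (p + 1) → Fin d → ℝ) → ℝ≥0∞,
      (∀ β ∈ K, ∀ x, ‖M.score β x‖ₑ ≤ G x) ∧ ∫⁻ x, G x ∂μ ≠ ∞ := by
  refine ⟨_, fun β hβ x => ?_, (h.2.2 (Prod.fst '' K) ?_ (Prod.snd '' K) ?_
    (hK.image continuous_fst) (hK.image continuous_snd)).ne⟩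
  · refine le_trans le_self_add (le_iSup₂_of_le β.1 (Set.mem_image_of_mem _ hβ)
      (le_iSup₂_of_le β.2 (Set.mem_image_of_mem _ hβ) le_rfl))
  · rintro _ ⟨β, hβ, rfl⟩
    exact (hKsub hβ).1
  · rintro _ ⟨β, hβ, rfl⟩
    exact (hKsub hβ).2

/-- With probability tending to one, the estimating equations have no solution in a compact set of
parameters that does not contain the pseudo-true value. -/
lemma tendsto_measure_exists_solvesEstimatingEquation {Ω : Type*} [MeasurableSpace Ω]
    {P : Measure Ω} [IsProbabilityMeasure P] {X : ℤ → Ω → Fin d → ℝ} (hX : ∀ t, Measurable (X t))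
    (hstat : StrictlyStationary P X) (hreg : AbsolutelyRegular P X)
    (hstar : M.IsPseudoTrue (P.map (window p X 1)) αstar)
    (hP1 : M.CondP1 (P.map (window p X 1)) αstar) (hP2 : M.CondP2 (P.map (window p X 1)))
    (r : M.V.EdgeClass → ℕ) {K : Set (M.EtaSpace × M.ThetaSpace)}
    (hKsub : K ⊆ M.etaSet ×ˢ M.thetaSet) (hK : IsCompact K) (hαK : αstar ∉ K) :
    Tendsto (fun T => P {ω | ∃ β ∈ K, SolvesEstimatingEquation M X r T ω β}) atTop (𝓝 0) := by
  obtain ⟨G, hG, hGi⟩ := hP2.exists_envelope hKsub hK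
  have hsep := hK.isSeparable
  have hW := fun t : ℕ => hstat.measurePreserving_window hX p t
  have hmix := hreg.pairwiseAsymptoticallyIndep_window hstat hX p
  refine tendsto_measure_exists_of_isCompact hK fun β hβ => ?_
  have hne := hP1.integral_score_ne_zero (hKsub hβ) fun h => hαK (h ▸ hβ)
  -- A continuous linear functional of the score that is nonzero in expectation, and whose sample
  -- mean over the first `n T` windows vanishes for every solution, rules out solutions near `β`.
  have key : ∀ {F : Type} [NormedAddCommGroup F] [NormedSpace ℝ F] [CompleteSpace F]
      (L : M.EtaSpace × M.ThetaSpace →L[ℝ] F) (n : ℕ → ℕ), (∀ v, ‖L v‖ₑ ≤ ‖v‖ₑ) →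
      L (∫ x, M.score β x ∂P.map (window p X 1)) ≠ 0 → Tendsto n atTop atTop →
      (∀ᶠ T in atTop, ∀ ω β', SolvesEstimatingEquation M X r T ω β' →
        ∑ t ∈ Finset.Icc 1 (n T), L (M.score β' (window p X (t : ℤ) ω)) = 0) →
      ∃ U ∈ 𝓝[K] β, Tendsto (fun T => P {ω | ∃ β' ∈ U, SolvesEstimatingEquation M X r T ω β'})
        atTop (𝓝 0) := by
    intro F _ _ _ L n hL hLne hn hsol
    rw [← L.integral_comp_comm (hP1.integrable_score hstar (hKsub hβ))] at hLne
    obtain ⟨U, hU, hlim⟩ := exists_nhdsWithin_tendsto_measure_exists_sum_eq_zero hW hmix hsep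
      (s := fun β x => L (M.score β x))
      (fun β' hβ' => L.continuous.comp_aestronglyMeasurable
        (hP1.integrable_score hstar (hKsub hβ')).1)
      (hP2.2.1.mono fun x hx => L.continuous.comp_continuousOn (hx.continuousOn.mono hKsub))
      (fun β' hβ' x => (hL _).trans (hG β' hβ' x)) hGi hβ hLne
    refine ⟨U, hU, tendsto_of_tendsto_of_tendsto_of_le_of_le' tendsto_const_nhds (hlim.comp hn)
      (Eventually.of_forall fun _ => zero_le) ?_⟩
    filter_upwards [hsol] with T hT
    refine measure_mono ?_
    rintro ω ⟨β', hβ', hs⟩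
    exact ⟨β', hβ', hT ω β' hs⟩
  have hT0 : ∀ᶠ T : ℕ in atTop, (T : ℝ)⁻¹ ≠ 0 :=
    (eventually_ge_atTop 1).mono fun T hT => inv_ne_zero (Nat.cast_ne_zero.2 (by omega))
  by_cases hη : ∃ j, (∫ x, M.score β x ∂P.map (window p X 1)).1 j ≠ 0
  · obtain ⟨j, hj⟩ := hη
    refine key ((ContinuousLinearMap.proj j).comp (ContinuousLinearMap.fst ℝ M.EtaSpace
      M.ThetaSpace)) id (fun v => M.enorm_fst_apply_le v j) hj tendsto_id ?_
    filter_upwards [hT0] with T hT ω β' hs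
    exact (smul_eq_zero.1 (hs.2.1 j)).resolve_left hT
  · push Not at hη
    obtain ⟨q, hq⟩ : ∃ q, (∫ x, M.score β x ∂P.map (window p X 1)).2 q ≠ 0 := by
      by_contra! hθ
      exact hne (Prod.ext (funext hη) (funext hθ))
    refine key ((ContinuousLinearMap.proj q).comp (ContinuousLinearMap.snd ℝ M.EtaSpace
      M.ThetaSpace)) (fun T => T - r q) (fun v => M.enorm_snd_apply_le v q) hq
      (tendsto_sub_atTop_nat _) ?_
    filter_upwards [hT0] with T hT ω β' hs
    exact (smul_eq_zero.1 (hs.2.2 q)).resolve_left hT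

end Model

end Consistency

end SVine

theorem mainTheorem11 {Ω : Type*} [MeasurableSpace Ω] (P : MeasureTheory.Measure Ω)
    [MeasureTheory.IsProbabilityMeasure P] {d p : ℕ}
    (X : ℤ → Ω → Fin d → ℝ) (hX : ∀ t, Measurable (X t))
    (hstat : SVine.StrictlyStationary P X) (hreg : SVine.AbsolutelyRegular P X)
    (M : SVine.Model d p)
    (αstar : M.EtaSpace × M.ThetaSpace)
    (hstar : M.IsPseudoTrue (P.map (SVine.window p X 1)) αstar)
    (hP1 : M.CondP1 (P.map (SVine.window p X 1)) αstar)
    (hP2 : M.CondP2 (P.map (SVine.window p X 1)))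
    (r : M.V.EdgeClass → ℕ)
    (αhat : ℕ → Ω → M.EtaSpace × M.ThetaSpace)
    (hsol : Filter.Tendsto
      (fun T : ℕ => P {ω | ¬ SVine.SolvesEstimatingEquation M X r T ω (αhat T ω)})
      Filter.atTop (nhds 0))
    (htight : ∀ δ : ENNReal, 0 < δ → ∃ K ⊆ M.etaSet ×ˢ M.thetaSet, IsCompact K ∧
      ∀ᶠ T : ℕ in Filter.atTop, P {ω | αhat T ω ∉ K} ≤ δ) :
    MeasureTheory.TendstoInMeasure P αhat Filter.atTop (fun _ => αstar) :=
  SVine.tendstoInMeasure_of_tendsto_measure_exists hsol htight fun _ hKsub hK hαK =>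
    SVine.Model.tendsto_measure_exists_solvesEstimatingEquation hX hstat hreg hstar hP1 hP2 r
      hKsub hK hαK
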